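/- Let $\mathcal X$ be a Banach space and $\mathcal C\subset\mathcal X$ a closed convex cone with $\mathcal C\cap(-\mathcal C)=\{0\}$ and interior $\mathcal C_0$. Write $x\le y$ if $y-x\in\mathcal C$. For $x,y\in\mathcal C_0$ let $d_T(x,y)=\log\max\{M(x/y),M(y/x)\}$, where $M(x/y)=\inf\{t\in\mathbb R: x\le ty\}$ (Thompson's part metric). Let $J=[0,T)$ with $0<T\le+\infty$, and let $\phi:J\times\mathcal C_0\to\mathcal X$ be continuous and Fréchet differentiable in the second variable, with derivative $D\phi_t(x)$; assume that for every closed bounded set $K\subset\mathcal X$ with $K\subset\mathcal C_0$ there is a constant $L$ with $\|D\phi_t(x)\|\le L$ for all $t\in J$, $x\in K$. For $s\in J$ and $x\in\mathcal C_0$ let $t\mapsto M_s^t(x)$ be the maximal solution in $\mathcal C_0$, on a subinterval of $J$ starting at $s$, of $\dot x(t)=\phi(t,x(t))$, $x(s)=x$, and let $t_{\mathcal C_0}(s,x)\le T$ be the supremum of the times up to which it exists and stays in $\mathcal C_0$. Let $\alpha\in\mathbb R$. Suppose that the flow is order-preserving on $\mathcal C_0$: if $x_1,x_2\in\mathcal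 C_0$ and $x_1\ge x_2$, then $M_s^t(x_1)\ge M_s^t(x_2)$ whenever $0\le s\le t<\min\{t_{\mathcal C_0}(s,x_1),t_{\mathcal C_0}(s,x_2)\}$. Then the following are equivalent: (a) for all $x_1,x_2\in\mathcal C_0$, $d_T(M_s^t(x_1),M_s^t(x_2))\le e^{-\alpha(t-s)}d_T(x_1,x_2)$ whenever $0\le s\le t<\min\{t_{\mathcal C_0}(s,x_1),t_{\mathcal C_0}(s,x_2)\}$; (b) for all $s\in J$ and $x\in\mathcal C_0$, $D\phi_s(x)x-\phi(s,x)\le-\alpha x$. If either of these conditions holds and the cone $\mathcal C$ is normal (there is a constant $\gamma$ such that $0\le x\le y$ implies $\|x\|\le\gamma\|y\|$; this is automatic if $\dim\mathcal X<\infty$), then the flow leaves $\mathcal C_0$ invariant, i.e. $t_{\mathcal C_0}(s,x)=T$ for all $s\in J$ and $x\in\mathcal C_0$. -/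

import Mathlib

open Set

noncomputable section

namespace ConeFlow

variable {X : Type*} [NormedAddCommGroup X] [NormedSpace ℝ X]

/-- The order `x ≤ y ↔ y - x ∈ C` induced by the cone `C`. -/
def ConeLE (C : ProperCone ℝ X) (x y : X) : Prop := y - x ∈ C

/-- `C ∩ (-C) = {0}`. (A `ProperCone` is a closed convex cone containing `0`.) -/
def IsPointed (C : ProperCone ℝ X) : Prop :=
  (C : Set X) ∩ {x | -x ∈ C} = {0}

/-- `C` is a normal cone: `0 ≤ x ≤ y` implies `‖x‖ ≤ γ * ‖y‖`, with a constant `γ` independent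
of `x` and `y`. -/
def IsNormalCone (C : ProperCone ℝ X) : Prop :=
  ∃ γ : ℝ, ∀ x y : X, ConeLE C 0 x → ConeLE C x y → ‖x‖ ≤ γ * ‖y‖

/-- `C₀`, the interior of `C`. -/
def coneInterior (C : ProperCone ℝ X) : Set X := interior (C : Set X)

/-- `M(x/y) = inf {t ∈ ℝ : x ≤ t y}`. -/
def gaugeM (C : ProperCone ℝ X) (x y : X) : ℝ := sInf {t : ℝ | ConeLE C x (t • y)}

/-- Thompson's part metric `d_T(x,y) = log (max {M(x/y), M(y/x)})`, for `x, y ∈ C₀`. -/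
def thompsonDist (C : ProperCone ℝ X) (x y : X) : ℝ :=
  Real.log (max (gaugeM C x y) (gaugeM C y x))

/-- The time interval `J = [0,T)`, with `T` possibly `+∞`. -/
def timeInterval (T : EReal) : Set ℝ := {t : ℝ | 0 ≤ t ∧ (t : EReal) < T}

/-- `x` solves `ẋ(t) = φ(t, x(t))`, `x(s) = x₀` on `[s,b)`, with values in `D`. The derivative is
taken within `[s,∞)`, so it is two-sided for `t > s` and one-sided at `t = s`. (It is continuous
in `t` whenever `φ` is continuous on `[s,b) × D`.) -/
def IsSolution (φ : ℝ → X → X) (D : Set X) (s : ℝ) (x₀ : X) (b : EReal) (x : ℝ → X) : Prop :=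
  x s = x₀ ∧ ∀ t : ℝ, s ≤ t → (t : EReal) < b →
    x t ∈ D ∧ HasDerivWithinAt x (φ t (x t)) (Ici s) t

/-- The end `a` of the existence interval `[s,a) ⊆ [0,T)` of the maximal solution. -/
def maxTime (φ : ℝ → X → X) (D : Set X) (T : EReal) (s : ℝ) (x₀ : X) : EReal :=
  sSup {b : EReal | (s : EReal) < b ∧ b ≤ T ∧ ∃ x : ℝ → X, IsSolution φ D s x₀ b x}

open Classical in
/-- The flow `M_s^t(x₀)`: the value at time `t ∈ [s,a)` of the solution starting from `x₀` at time
`s`. The value for other `t` is immaterial. -/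
def flow (φ : ℝ → X → X) (D : Set X) (T : EReal) (s t : ℝ) (x₀ : X) : X :=
  if h : ∃ x : ℝ → X, ∃ b : EReal, (t : EReal) < b ∧ b ≤ T ∧ IsSolution φ D s x₀ b x then
    h.choose t
  else x₀

/-- `t_U(s,x₀) = sup {b ∈ (s,a) : M_s^t(x₀) ∈ U for all t ∈ [s,b)}`, the first time when the
trajectory leaves `U`. -/
def exitTime (φ : ℝ → X → X) (D : Set X) (T : EReal) (U : Set X) (s : ℝ) (x₀ : X) : EReal :=
  sSup {b : EReal | (s : EReal) < b ∧ b < maxTime φ D T s x₀ ∧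
    ∀ t : ℝ, s ≤ t → (t : EReal) < b → flow φ D T s t x₀ ∈ U}

/-- The flow is order-preserving on `U`. -/
def IsOrderPreservingOn (C : ProperCone ℝ X) (φ : ℝ → X → X) (D : Set X) (T : EReal)
    (U : Set X) : Prop :=
  ∀ x₁ ∈ U, ∀ x₂ ∈ U, ConeLE C x₂ x₁ → ∀ s t : ℝ, 0 ≤ s → s ≤ t →
    (t : EReal) < min (exitTime φ D T U s x₁) (exitTime φ D T U s x₂) →
      ConeLE C (flow φ D T s t x₂) (flow φ D T s t x₁)

/-- The flow contracts Thompson's metric on `U` with rate `α ∈ ℝ`. -/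
def ContractsThompson (C : ProperCone ℝ X) (φ : ℝ → X → X) (D : Set X) (T : EReal)
    (U : Set X) (α : ℝ) : Prop :=
  ∀ x₁ ∈ U, ∀ x₂ ∈ U, ∀ s t : ℝ, 0 ≤ s → s ≤ t →
    (t : EReal) < min (exitTime φ D T U s x₁) (exitTime φ D T U s x₂) →
      thompsonDist C (flow φ D T s t x₁) (flow φ D T s t x₂) ≤
        Real.exp (-α * (t - s)) * thompsonDist C x₁ x₂

/-- `Dφ_s(x) x - φ(s,x) ≤ -α x` for all `s ∈ J` and `x ∈ U`. -/
def InfinitesimalContraction (C : ProperCone ℝ X) (φ : ℝ → X → X) (T : EReal)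
    (U : Set X) (α : ℝ) : Prop :=
  ∀ s ∈ timeInterval T, ∀ x ∈ U, ConeLE C (fderiv ℝ (φ s) x x - φ s x) (-(α • x))

/-- The regularity assumptions on `φ` on `J × D`, `J = [0,T)`: joint continuity, Fréchet
differentiability in the second variable, and a bound on the derivative, uniform in time, on each
closed bounded subset of `D`. -/
structure IsRegularField (φ : ℝ → X → X) (D : Set X) (T : EReal) : Prop where
  continuousOn : ContinuousOn (fun p : ℝ × X => φ p.1 p.2) (timeInterval T ×ˢ D)
  differentiableAt : ∀ t ∈ timeInterval T, ∀ x ∈ D, DifferentiableAt ℝ (φ t) x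
  bounded_fderiv : ∀ K : Set X, K ⊆ D → IsClosed K → Bornology.IsBounded K →
    ∃ L : ℝ, ∀ t ∈ timeInterval T, ∀ x ∈ K, ‖fderiv ℝ (φ t) x‖ ≤ L

end ConeFlow

end

noncomputable section

namespace ConeFlow

open Topology

variable {X : Type*} [NormedAddCommGroup X] [NormedSpace ℝ X]
variable {φ : ℝ → X → X} {D : Set X} {T : EReal}

/-! The bridge between the two conditions is the integrated inequality `φ(t, eʳx) ≤ eʳ(φ(t,x) -
αrx)` for `r ≥ 0`, i.e. `scalingDefect ∈ C`. The `r`-derivative of the defect is `e⁻ʳ` times the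
slack in the infinitesimal condition at `eʳx`, so integrating from `r = 0` gives one direction and
differentiating at `r = 0` the other.

On interior points, `d_T(x,y) ≤ r` means `x ≤ eʳy` and `y ≤ eʳx`. If `x` is a trajectory and `ρ(t) =
e^{-α(t-s)} r`, the integrated inequality says that `e^{ρ(t)} x(t)` is a supersolution. The
comparison principle `IsOrderPreservingOn.sub_mem_of_subsolution` keeps it above every trajectory
that starts below it, which is the contraction. Conversely, contraction applied to the trajectories
from `x` and `eʳx`, differentiated at the initial time, returns the integrated inequality.

For invariance, `e^{-u(t)} x₀` and `e^{u(t)} x₀`, with `u` growing exponentially, are a sub- and a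
supersolution, so up to any finite time before `T` a trajectory stays in an order interval inside
the interior. Normality makes this interval bounded, hence the speed is bounded, the trajectory has
a limit in the interior, and it can be continued. -/

/-! ### Local existence, uniqueness and continuation for the differential equation. -/

theorem exists_add_lt_of_lt {a : ℝ} {b : EReal} (h : (a : EReal) < b) :
    ∃ ε > (0 : ℝ), ((a + ε : ℝ) : EReal) < b := by
  obtain ⟨c, hac, hcb⟩ := EReal.lt_iff_exists_real_btwn.1 h
  refine ⟨c - a, sub_pos.2 (EReal.coe_lt_coe_iff.1 hac), ?_⟩
  simpa using hcb

theorem mem_timeInterval_of_le {a t : ℝ} (ha : (a : EReal) < T) (h0 : 0 ≤ t) (h : t ≤ a) :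
    t ∈ timeInterval T :=
  ⟨h0, (EReal.coe_le_coe_iff.2 h).trans_lt ha⟩

/-- On a closed bounded convex subset of `D` the field is Lipschitz, uniformly in time. -/
theorem IsRegularField.exists_lipschitzOnWith (hφ : IsRegularField φ D T) {K : Set X}
    (hKD : K ⊆ D) (hKc : IsClosed K) (hKb : Bornology.IsBounded K) (hKconv : Convex ℝ K) :
    ∃ L : NNReal, ∀ t ∈ timeInterval T, LipschitzOnWith L (φ t) K := by
  obtain ⟨L, hL⟩ := hφ.bounded_fderiv K hKD hKc hKb
  refine ⟨L.toNNReal, fun t ht => hKconv.lipschitzOnWith_of_nnnorm_fderiv_le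
    (fun x hx => hφ.differentiableAt t ht x (hKD hx)) fun x hx => ?_⟩
  exact NNReal.coe_le_coe.1 ((hL t ht x hx).trans (Real.le_coe_toNNReal L))

/-- The field is continuous in time at each point of `D`. -/
theorem IsRegularField.continuousOn_const (hφ : IsRegularField φ D T) {p : X} (hp : p ∈ D) :
    ContinuousOn (fun t => φ t p) (timeInterval T) :=
  hφ.continuousOn.comp (f := fun t : ℝ => (t, p)) (by fun_prop) fun _ ht => ⟨ht, hp⟩

/-- The solution given by the Picard-Lindelöf theorem stays in the ball. -/
theorem exists_hasDerivWithinAt_mem_closedBall [CompleteSpace X] {tmin tmax : ℝ}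
    {t₀ : Icc tmin tmax} {x₀ q : X} {a r L K : NNReal} (hf : IsPicardLindelof φ t₀ x₀ a r L K)
    (hq : q ∈ Metric.closedBall x₀ r) : ∃ x : ℝ → X, x t₀ = q ∧ ∀ t ∈ Icc tmin tmax,
      HasDerivWithinAt x (φ t (x t)) (Icc tmin tmax) t ∧ x t ∈ Metric.closedBall x₀ a := by
  obtain ⟨γ, hγ⟩ := ODE.FunSpace.exists_isFixedPt_next hf hq
  refine ⟨γ.compProj, by rw [ODE.FunSpace.compProj_val, ← hγ, ODE.FunSpace.next_apply₀],
    fun t ht => ⟨?_, γ.compProj_mem_closedBall hf.mul_max_le⟩⟩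
  apply ODE.hasDerivWithinAt_picard_Icc t₀.2 hf.continuousOn_uncurry
    γ.continuous_compProj.continuousOn (fun _ _ => γ.compProj_mem_closedBall hf.mul_max_le)
    q ht |>.congr_of_mem _ ht
  intro t' ht'
  nth_rw 1 [← hγ]
  rw [ODE.FunSpace.compProj_of_mem ht', ODE.FunSpace.next_apply]

/-- Local solvability, with an existence time that is uniform near `(a, p)`. -/
theorem IsRegularField.exists_local_solution [CompleteSpace X] (hD : IsOpen D)
    (hφ : IsRegularField φ D T) {a : ℝ} (ha : a ∈ timeInterval T) {p : X} (hp : p ∈ D) :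
    ∃ h > (0 : ℝ), ((a + h : ℝ) : EReal) < T ∧ ∃ r > (0 : ℝ), ∀ t₀ : ℝ, 0 ≤ t₀ → a - h ≤ t₀ →
      t₀ ≤ a → ∀ q ∈ Metric.closedBall p r, ∃ x : ℝ → X,
        IsSolution φ D t₀ q ((a + h : ℝ) : EReal) x := by
  obtain ⟨δ₁, hδ₁, hball⟩ := Metric.nhds_basis_closedBall.mem_iff.1 (hD.mem_nhds hp)
  have hc := hφ.continuousOn (a, p) ⟨ha, hp⟩
  have hbd : ∀ᶠ z in 𝓝[timeInterval T ×ˢ D] (a, p), ‖φ z.1 z.2‖ < ‖φ a p‖ + 1 :=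
    hc.norm.eventually (gt_mem_nhds (lt_add_one _))
  obtain ⟨δ₂, hδ₂, hbd⟩ := Metric.mem_nhdsWithin_iff.1 hbd
  obtain ⟨ε, hε, hεT⟩ := exists_add_lt_of_lt ha.2
  obtain ⟨δ, hδ, hδ₁', hδ₂'⟩ : ∃ δ > 0, δ ≤ δ₁ ∧ δ < δ₂ :=
    ⟨min δ₁ (δ₂ / 2), by positivity, min_le_left _ _, (min_le_right _ _).trans_lt (by linarith)⟩
  have hBD : Metric.closedBall p δ ⊆ D := (Metric.closedBall_subset_closedBall hδ₁').trans hball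
  obtain ⟨L, hL⟩ := hφ.exists_lipschitzOnWith hBD Metric.isClosed_closedBall
    Metric.isBounded_closedBall (convex_closedBall p δ)
  set M : ℝ := ‖φ a p‖ + 1 with hM
  have hMpos : 0 < M := by positivity
  -- Solutions run on `[t₀, a + h]`, of length at most `2h`. At speed `M` they travel at most `δ/2`,
  -- the gap between the radius `δ/2` of admissible initial data and the ball of radius `δ`.
  set h : ℝ := min (min ε (δ₂ / 2)) (δ / (4 * M)) with hh
  have hhpos : 0 < h := by positivity
  have hhε : h ≤ ε := (min_le_left _ _).trans (min_le_left _ _)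
  have hhδ₂ : h < δ₂ := by
    have : h ≤ δ₂ / 2 := (min_le_left _ _).trans (min_le_right _ _)
    linarith
  have hhM : M * (2 * h) ≤ δ - δ / 2 := by
    have : h ≤ δ / (4 * M) := min_le_right _ _
    rw [le_div_iff₀ (by positivity)] at this
    linarith
  have hT : ((a + h : ℝ) : EReal) < T :=
    (EReal.coe_le_coe_iff.2 (by linarith)).trans_lt hεT
  refine ⟨h, hhpos, hT, δ / 2, by positivity, fun t₀ h0 h1 h2 q hq => ?_⟩
  have hJ : ∀ t ∈ Icc t₀ (a + h), t ∈ timeInterval T := fun t ht =>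
    mem_timeInterval_of_le hT (h0.trans ht.1) ht.2
  have hPL : IsPicardLindelof φ (tmin := t₀) (tmax := a + h) ⟨t₀, le_rfl, by linarith⟩ p
      ⟨δ, hδ.le⟩ ⟨δ / 2, by positivity⟩ ⟨M, hMpos.le⟩ L := by
    refine ⟨fun t ht => hL t (hJ t ht), fun x hx =>
      (hφ.continuousOn_const (hBD (by exact hx))).mono hJ, fun t ht x hx => ?_, ?_⟩
    · have hx : x ∈ Metric.closedBall p δ := hx
      refine (@hbd (t, x) ⟨?_, hJ t ht, hBD hx⟩).le
      rw [Metric.mem_ball, Prod.dist_eq, max_lt_iff]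
      refine ⟨?_, (Metric.mem_closedBall.1 hx).trans_lt hδ₂'⟩
      rw [Real.dist_eq, abs_lt]
      constructor <;> linarith [ht.1, ht.2]
    · change M * max (a + h - t₀) (t₀ - t₀) ≤ δ - δ / 2
      refine le_trans (mul_le_mul_of_nonneg_left ?_ hMpos.le) hhM
      rw [max_le_iff]
      constructor <;> linarith
  obtain ⟨x, hx0, hx⟩ := exists_hasDerivWithinAt_mem_closedBall hPL hq
  refine ⟨x, hx0, fun t h3 h4 => ?_⟩
  have hta : t < a + h := EReal.coe_lt_coe_iff.1 h4
  obtain ⟨hd, hm⟩ := hx t ⟨h3, hta.le⟩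
  exact ⟨hBD hm, hd.mono_of_mem_nhdsWithin
    (Filter.inter_mem self_mem_nhdsWithin (mem_nhdsWithin_of_mem_nhds (Iic_mem_nhds hta)))⟩

/-- Solutions are unique. -/
theorem IsSolution.eqOn (hD : IsOpen D) (hφ : IsRegularField φ D T) {s : ℝ} (hs : 0 ≤ s)
    {x₀ : X} {b₁ b₂ : EReal} (hb₁ : b₁ ≤ T) {x y : ℝ → X} (hx : IsSolution φ D s x₀ b₁ x)
    (hy : IsSolution φ D s x₀ b₂ y) {t : ℝ} (hst : s ≤ t) (ht₁ : (t : EReal) < b₁)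
    (ht₂ : (t : EReal) < b₂) : x t = y t := by
  have lt_of : ∀ {b : EReal}, (t : EReal) < b → ∀ τ ∈ Icc s t, (τ : EReal) < b := fun h τ hτ =>
    (EReal.coe_le_coe_iff.2 hτ.2).trans_lt h
  have hxc : ContinuousOn x (Icc s t) := fun τ hτ =>
    (hx.2 τ hτ.1 (lt_of ht₁ τ hτ)).2.continuousWithinAt.mono Icc_subset_Ici_self
  have hyc : ContinuousOn y (Icc s t) := fun τ hτ =>
    (hy.2 τ hτ.1 (lt_of ht₂ τ hτ)).2.continuousWithinAt.mono Icc_subset_Ici_self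
  have hclosed : IsClosed ({τ | x τ = y τ} ∩ Icc s t) := by
    have := (hxc.sub hyc).preimage_isClosed_of_isClosed isClosed_Icc (isClosed_singleton (x := 0))
    convert this using 1
    ext τ
    simp [sub_eq_zero, and_comm]
  -- Continuous induction: the coincidence set is closed, and from each of its points both solutions
  -- remain for a while in one ball where the field is Lipschitz.
  refine hclosed.Icc_subset_of_forall_exists_gt (hx.1.trans hy.1.symm) ?_ ⟨hst, le_rfl⟩
  rintro u ⟨hu, hut⟩ v hv
  have hmem : x u ∈ D := (hx.2 u hut.1 (lt_of ht₁ u ⟨hut.1, hut.2.le⟩)).1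
  obtain ⟨δ, hδ, hball⟩ := Metric.nhds_basis_closedBall.mem_iff.1 (hD.mem_nhds hmem)
  obtain ⟨L, hL⟩ := hφ.exists_lipschitzOnWith hball Metric.isClosed_closedBall
    Metric.isBounded_closedBall (convex_closedBall (x u) δ)
  have key : ∀ z : ℝ → X, ContinuousOn z (Icc s t) → z u = x u →
      ∀ᶠ τ in 𝓝[≥] u, z τ ∈ Metric.closedBall (x u) δ := by
    intro z hz hzu
    have : ContinuousWithinAt z (Ici u) u :=
      (hz u ⟨hut.1, hut.2.le⟩).mono_of_mem_nhdsWithin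
        (Filter.mem_of_superset (Icc_mem_nhdsGE hut.2) (Icc_subset_Icc_left hut.1))
    exact this.eventually_mem (by rw [hzu]; exact Metric.closedBall_mem_nhds _ hδ)
  obtain ⟨w, hw, hwsub⟩ := mem_nhdsGE_iff_exists_Icc_subset.1
    ((key x hxc rfl).and (key y hyc hu.symm))
  set m := min (min v t) w
  have hum : u < m := lt_min (lt_min hv hut.2) hw
  have hmt : m ≤ t := (min_le_left _ _).trans (min_le_right _ _)
  have hmw : m ≤ w := min_le_right _ _
  have hsub : ∀ τ ∈ Ico u m, τ ∈ Icc s t := fun τ hτ => ⟨hut.1.trans hτ.1, hτ.2.le.trans hmt⟩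
  have hss : Icc u m ⊆ Icc s t := Icc_subset_Icc hut.1 hmt
  refine ⟨m, ODE_solution_unique_of_mem_Icc_right (v := φ) (s := fun _ => Metric.closedBall (x u) δ)
    (K := L) (fun τ hτ => hL τ ?_) (hxc.mono hss) (fun τ hτ => ?_) (fun τ hτ => ?_)
    (hyc.mono hss) (fun τ hτ => ?_) (fun τ hτ => ?_) hu ⟨hum.le, le_rfl⟩, hum,
    (min_le_left _ _).trans (min_le_left _ _)⟩
  · exact mem_timeInterval_of_le (ht₁.trans_le hb₁) (hs.trans (hsub τ hτ).1) (hsub τ hτ).2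
  · exact (hx.2 τ (hsub τ hτ).1 (lt_of ht₁ τ (hsub τ hτ))).2.mono (Ici_subset_Ici.2 (hsub τ hτ).1)
  · exact (hwsub ⟨hτ.1, hτ.2.le.trans hmw⟩).1
  · exact (hy.2 τ (hsub τ hτ).1 (lt_of ht₂ τ (hsub τ hτ))).2.mono (Ici_subset_Ici.2 (hsub τ hτ).1)
  · exact (hwsub ⟨hτ.1, hτ.2.le.trans hmw⟩).2

/-- The solution chosen in `flow` may differ from one time to the next; uniqueness makes the choice
harmless. -/
theorem flow_eq_of_isSolution (hD : IsOpen D) (hφ : IsRegularField φ D T) {s : ℝ} (hs : 0 ≤ s)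
    {x₀ : X} {b : EReal} (hb : b ≤ T) {x : ℝ → X} (hx : IsSolution φ D s x₀ b x) {t : ℝ}
    (hst : s ≤ t) (ht : (t : EReal) < b) : flow φ D T s t x₀ = x t := by
  have h : ∃ x : ℝ → X, ∃ b : EReal, (t : EReal) < b ∧ b ≤ T ∧ IsSolution φ D s x₀ b x :=
    ⟨x, b, ht, hb, hx⟩
  obtain ⟨b', hb', hb'T, hsol⟩ := h.choose_spec
  rw [flow, dif_pos h]
  exact hsol.eqOn hD hφ hs hb'T hx hst hb' ht

theorem maxTime_le {s : ℝ} {x₀ : X} : maxTime φ D T s x₀ ≤ T :=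
  sSup_le fun _ hb => hb.2.1

theorem le_maxTime {s : ℝ} {x₀ : X} {b : EReal} (hsb : (s : EReal) < b) (hb : b ≤ T)
    {x : ℝ → X} (hx : IsSolution φ D s x₀ b x) : b ≤ maxTime φ D T s x₀ :=
  le_sSup ⟨hsb, hb, x, hx⟩

theorem IsSolution.congr {s : ℝ} {x₀ : X} {b : EReal} {x y : ℝ → X}
    (hx : IsSolution φ D s x₀ b x) (hsb : (s : EReal) < b)
    (hxy : ∀ t, s ≤ t → (t : EReal) < b → y t = x t) : IsSolution φ D s x₀ b y := by
  refine ⟨(hxy s le_rfl hsb).trans hx.1, fun t hst ht => ?_⟩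
  rw [hxy t hst ht]
  refine ⟨(hx.2 t hst ht).1, (hx.2 t hst ht).2.congr_of_eventuallyEq ?_ (hxy t hst ht)⟩
  have : ∀ᶠ τ : ℝ in 𝓝[Ici s] t, (τ : EReal) < b :=
    nhdsWithin_le_nhds (continuous_coe_real_ereal.continuousAt.eventually (gt_mem_nhds ht))
  filter_upwards [this, self_mem_nhdsWithin] with τ h1 h2 using hxy τ h2 h1

theorem IsSolution.mono {s : ℝ} {x₀ : X} {b b' : EReal} {x : ℝ → X}
    (hx : IsSolution φ D s x₀ b x) (h : b' ≤ b) : IsSolution φ D s x₀ b' x :=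
  ⟨hx.1, fun t hst ht => hx.2 t hst (ht.trans_le h)⟩

theorem lt_maxTime [CompleteSpace X] (hD : IsOpen D) (hφ : IsRegularField φ D T) {s : ℝ}
    (hs : s ∈ timeInterval T) {x₀ : X} (hx₀ : x₀ ∈ D) : (s : EReal) < maxTime φ D T s x₀ := by
  obtain ⟨h, hh, hT, r, hr, hloc⟩ := hφ.exists_local_solution hD hs hx₀
  obtain ⟨x, hx⟩ := hloc s hs.1 (by linarith) le_rfl x₀ (Metric.mem_closedBall_self hr.le)
  have hlt : (s : EReal) < ((s + h : ℝ) : EReal) := EReal.coe_lt_coe_iff.2 (by linarith)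
  exact hlt.trans_le (le_maxTime hlt hT.le hx)

/-- The flow line of `x₀` is a solution up to the maximal time. -/
theorem isSolution_flow [CompleteSpace X] (hD : IsOpen D) (hφ : IsRegularField φ D T) {s : ℝ}
    (hs : s ∈ timeInterval T) {x₀ : X} (hx₀ : x₀ ∈ D) :
    IsSolution φ D s x₀ (maxTime φ D T s x₀) (fun t => flow φ D T s t x₀) := by
  have key : ∀ t : ℝ, (t : EReal) < maxTime φ D T s x₀ → s ≤ t → ∃ b, (t : EReal) < b ∧
      IsSolution φ D s x₀ b (fun t => flow φ D T s t x₀) := by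
    intro t ht hst
    obtain ⟨b, ⟨hsb, hbT, x, hx⟩, htb⟩ := lt_sSup_iff.1 ht
    exact ⟨b, htb, hx.congr hsb fun τ h1 h2 => flow_eq_of_isSolution hD hφ hs.1 hbT hx h1 h2⟩
  refine ⟨?_, fun t hst ht => ?_⟩
  · obtain ⟨b, -, hb⟩ := key s (lt_maxTime hD hφ hs hx₀) le_rfl
    exact hb.1
  · obtain ⟨b, htb, hb⟩ := key t ht hst
    exact hb.2 t hst htb

/-- Solutions take values in `D` by definition, so every `b` strictly between `s` and the maximal
time is admissible, and these `b` have the maximal time as supremum. -/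
theorem exitTime_eq_maxTime [CompleteSpace X] (hD : IsOpen D) (hφ : IsRegularField φ D T) {s : ℝ}
    (hs : s ∈ timeInterval T) {x₀ : X} (hx₀ : x₀ ∈ D) :
    exitTime φ D T D s x₀ = maxTime φ D T s x₀ := by
  refine le_antisymm (sSup_le fun b hb => hb.2.1.le) (le_of_forall_lt fun c hc => ?_)
  obtain ⟨b, hb, hbm⟩ := exists_between (max_lt hc (lt_maxTime hD hφ hs hx₀))
  refine (le_max_left _ _).trans_lt (hb.trans_le (le_sSup ⟨(le_max_right _ _).trans_lt hb, hbm, ?_⟩))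
  exact fun t hst ht => ((isSolution_flow hD hφ hs hx₀).2 t hst (ht.trans hbm)).1

/-- A solution on `[s,a)`, `a < T`, that stays in a closed subset of `D` and is Lipschitz in time
extends beyond `a`. -/
theorem lt_maxTime_of_lipschitzOnWith [CompleteSpace X] (hD : IsOpen D)
    (hφ : IsRegularField φ D T) {s a : ℝ} (hs : 0 ≤ s) (hsa : s < a) (haT : (a : EReal) < T)
    {x₀ : X} {x : ℝ → X} (hx : IsSolution φ D s x₀ a x) {K : Set X} (hKD : K ⊆ D)
    (hK : IsClosed K) (hxK : ∀ t ∈ Ico s a, x t ∈ K) {L : NNReal}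
    (hL : LipschitzOnWith L x (Ico s a)) : (a : EReal) < maxTime φ D T s x₀ := by
  obtain ⟨u, -, hu, hua⟩ := exists_seq_strictMono_tendsto' hsa
  have hu' : ∀ n, u n ∈ Ico s a := fun n => ⟨(hu n).1.le, (hu n).2⟩
  have hcau : CauchySeq fun n => x (u n) := hL.cauchySeq_comp hua.cauchySeq (by
    rintro _ ⟨n, rfl⟩; exact hu' n)
  obtain ⟨p, hp⟩ := cauchySeq_tendsto_of_complete hcau
  have hpD : p ∈ D := hKD (hK.mem_of_tendsto hp (Filter.Eventually.of_forall fun n => hxK _ (hu' n)))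
  -- The existence time is uniform near the limit point `(a, p)`, so restarting at a late enough `u
  -- n` carries the solution past `a`.
  obtain ⟨h, hh, hT, r, hr, hloc⟩ := hφ.exists_local_solution hD
    (mem_timeInterval_of_le haT (hs.trans hsa.le) le_rfl) hpD
  obtain ⟨n, hn1, hn2⟩ := ((hua.eventually (lt_mem_nhds (show a - h < a by linarith))).and
    (hp.eventually (Metric.closedBall_mem_nhds p hr))).exists
  obtain ⟨y, hy⟩ := hloc (u n) (hs.trans (hu' n).1) hn1.le (hu' n).2.le _ hn2
  have hxn : IsSolution φ D (u n) (x (u n)) a x :=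
    ⟨rfl, fun t h1 h2 => ⟨(hx.2 t ((hu' n).1.trans h1) h2).1,
      (hx.2 t ((hu' n).1.trans h1) h2).2.mono (Ici_subset_Ici.2 (hu' n).1)⟩⟩
  have heq : ∀ t, u n ≤ t → t < a → x t = y t := fun t h1 h2 =>
    hxn.eqOn hD hφ (hs.trans (hu' n).1) haT.le hy h1 (EReal.coe_lt_coe_iff.2 h2)
      (EReal.coe_lt_coe_iff.2 (by linarith))
  have hsol : IsSolution φ D s x₀ ((a + h : ℝ) : EReal) (fun t => if t < a then x t else y t) := by
    refine ⟨by simp [hsa, hx.1], fun t hst ht => ?_⟩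
    by_cases hta : t < a
    · have := hx.2 t hst (EReal.coe_lt_coe_iff.2 hta)
      simp only [hta, if_true]
      refine ⟨this.1, this.2.congr_of_eventuallyEq ?_ (by simp [hta])⟩
      filter_upwards [nhdsWithin_le_nhds (gt_mem_nhds hta)] with τ hτ
      exact if_pos hτ
    · have hut : u n < t := (hu n).2.trans_le (not_lt.1 hta)
      have := hy.2 t hut.le ht
      simp only [hta, if_false]
      refine ⟨this.1, ((this.2.hasDerivAt (Ici_mem_nhds hut)).congr_of_eventuallyEq
        ?_).hasDerivWithinAt⟩
      filter_upwards [lt_mem_nhds hut] with τ hτ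
      split_ifs with h1
      · exact heq τ hτ.le h1
      · rfl
  have hlt : (a : EReal) < ((a + h : ℝ) : EReal) := EReal.coe_lt_coe_iff.2 (by linarith)
  exact hlt.trans_le (le_maxTime ((EReal.coe_lt_coe_iff.2 hsa).trans hlt) hT.le hsol)

/-! ### Order units, supporting functionals and monotone curves for the cone. -/

variable {C : ProperCone ℝ X}

theorem isOpen_coneInterior : IsOpen (coneInterior C) := isOpen_interior

theorem mem_of_mem_coneInterior {x : X} (hx : x ∈ coneInterior C) : x ∈ C := interior_subset hx

/-- An interior point of the cone is an order unit, with a linear bound. -/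
theorem exists_forall_smul_add_mem {e : X} (he : e ∈ coneInterior C) :
    ∃ κ : ℝ, 0 < κ ∧ ∀ v : X, (κ * ‖v‖) • e + v ∈ C := by
  obtain ⟨δ, hδ, hball⟩ := Metric.nhds_basis_closedBall.mem_iff.1 (mem_interior_iff_mem_nhds.1 he)
  refine ⟨δ⁻¹, inv_pos.2 hδ, fun v => ?_⟩
  rcases eq_or_ne v 0 with rfl | hv
  · simp
  have hv' : 0 < ‖v‖ := norm_pos_iff.2 hv
  have hmem : e + (δ / ‖v‖) • v ∈ C := hball (by
    rw [mem_closedBall_iff_norm, add_sub_cancel_left, norm_smul, Real.norm_of_nonneg (by positivity),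
      div_mul_cancel₀ _ hv'.ne'])
  have := C.smul_mem hmem (show 0 ≤ δ⁻¹ * ‖v‖ by positivity)
  rw [smul_add, smul_smul] at this
  convert this using 2
  rw [show δ⁻¹ * ‖v‖ * (δ / ‖v‖) = 1 by field_simp, one_smul]

theorem add_mem_coneInterior {x y : X} (hx : x ∈ coneInterior C) (hy : y ∈ C) :
    x + y ∈ coneInterior C := by
  refine mem_interior.2 ⟨(fun v => v - y) ⁻¹' coneInterior C, fun v hv => ?_,
    isOpen_coneInterior.preimage (by fun_prop), by simpa using hx⟩
  simpa using C.add_mem (mem_of_mem_coneInterior hv) hy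

theorem smul_mem_coneInterior {x : X} (hx : x ∈ coneInterior C) {r : ℝ} (hr : 0 < r) :
    r • x ∈ coneInterior C := by
  refine mem_interior.2 ⟨(fun v => r⁻¹ • v) ⁻¹' coneInterior C, fun v hv => ?_,
    isOpen_coneInterior.preimage (by fun_prop), by simpa [smul_smul, hr.ne'] using hx⟩
  have := C.smul_mem (mem_of_mem_coneInterior hv) hr.le
  simpa [smul_smul, hr.ne'] using this

/-- Half of the bipolar theorem, by separation; it reduces cone inequalities to scalar ones. -/
theorem mem_of_forall_dual_nonneg {v : X}
    (h : ∀ ψ : StrongDual ℝ X, (∀ x ∈ C, 0 ≤ ψ x) → 0 ≤ ψ v) : v ∈ C := by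
  by_contra hv
  obtain ⟨ψ, hψ, hneg⟩ := C.hyperplane_separation_point hv
  exact (h ψ hψ).not_gt hneg

/-- At a boundary point of the cone there is a supporting positive functional that does not vanish
at a given interior point. -/
theorem exists_supporting_functional {e p : X} (he : e ∈ coneInterior C) (hp : p ∈ C)
    (hp' : p ∉ coneInterior C) :
    ∃ ψ : StrongDual ℝ X, (∀ x ∈ C, 0 ≤ ψ x) ∧ 0 < ψ e ∧ ψ p = 0 := by
  -- Since `f < f p` on the interior, shrinking `e` to `0` gives `f p ≥ 0`, while a positive value
  -- of `f` could be scaled past `f p`. Thus `f ≤ 0` on the cone, `f p = 0`, and `-f` is the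
  -- functional.
  obtain ⟨f, hf⟩ := geometric_hahn_banach_open_point C.convex.interior isOpen_interior hp'
  have hfp : 0 ≤ f p := by
    by_contra! hneg
    have h1 : ∀ t > (0 : ℝ), t * f e < f p := fun t ht => by
      simpa using hf _ (smul_mem_coneInterior he ht)
    have hc : Filter.Tendsto (fun t : ℝ => t * f e) (𝓝[>] 0) (𝓝 (0 * f e)) :=
      (Continuous.tendsto (by fun_prop) 0).mono_left nhdsWithin_le_nhds
    rw [zero_mul] at hc
    exact (le_of_tendsto hc (eventually_nhdsWithin_of_forall fun t ht => (h1 t ht).le)).not_gt hneg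
  have hneg : ∀ x ∈ coneInterior C, f x ≤ 0 := by
    intro x hx
    by_contra! hpos
    have h1 := hf _ (smul_mem_coneInterior hx (show 0 < (f p + 1) / f x by positivity))
    rw [map_smul, smul_eq_mul, div_mul_cancel₀ _ hpos.ne'] at h1
    linarith
  have hneg' : ∀ x ∈ C, f x ≤ 0 := by
    intro x hx
    have h1 : ∀ t > (0 : ℝ), f x + t * f e ≤ 0 := fun t ht => by
      have := hneg _ (add_mem_coneInterior (smul_mem_coneInterior he ht) hx)
      rw [map_add, map_smul, smul_eq_mul] at this
      linarith
    have hc : Filter.Tendsto (fun t : ℝ => f x + t * f e) (𝓝[>] 0) (𝓝 (f x + 0 * f e)) :=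
      (Continuous.tendsto (by fun_prop) 0).mono_left nhdsWithin_le_nhds
    rw [zero_mul, add_zero] at hc
    exact le_of_tendsto hc (eventually_nhdsWithin_of_forall h1)
  have hp0 : f p = 0 := le_antisymm (hneg' p hp) hfp
  exact ⟨-f, fun x hx => by simpa using hneg' x hx, by simpa [hp0] using hf e he, by simp [hp0]⟩

/-- The right derivative of a curve entering the cone at its vertex lies in the cone. -/
theorem mem_of_hasDerivWithinAt {g : ℝ → X} {g' : X} {s b : ℝ} (hsb : s < b)
    (hg : HasDerivWithinAt g g' (Ici s) s) (h0 : g s = 0) (hmem : ∀ t ∈ Ioo s b, g t ∈ C) :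
    g' ∈ C := by
  have h := (hasDerivWithinAt_iff_tendsto_slope' self_notMem_Ioi).1 hg.Ioi_of_Ici
  refine C.isClosed.mem_of_tendsto h ?_
  filter_upwards [Ioo_mem_nhdsGT hsb] with t ht
  rw [slope_def_module, h0, sub_zero]
  exact C.smul_mem (hmem t ht) (inv_nonneg.2 (sub_nonneg.2 ht.1.le))

/-- A curve whose derivative lies in the cone is increasing. -/
theorem sub_mem_of_hasDerivAt {g g' : ℝ → X} {a b : ℝ} (hab : a ≤ b)
    (hg : ∀ t ∈ Icc a b, HasDerivAt g (g' t) t) (hg' : ∀ t ∈ Icc a b, g' t ∈ C) :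
    g b - g a ∈ C := by
  refine mem_of_forall_dual_nonneg fun ψ hψ => ?_
  have hd : ∀ t ∈ Icc a b, HasDerivAt (fun t => ψ (g t)) (ψ (g' t)) t := fun t ht =>
    ψ.hasFDerivAt.comp_hasDerivAt t (hg t ht)
  have : MonotoneOn (fun t => ψ (g t)) (Icc a b) :=
    monotoneOn_of_deriv_nonneg (convex_Icc a b)
      (fun t ht => (hd t ht).continuousAt.continuousWithinAt)
      (fun t ht => (hd t (interior_subset ht)).differentiableAt.differentiableWithinAt)
      fun t ht => by
        rw [(hd t (interior_subset ht)).deriv]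
        exact hψ _ (hg' t (interior_subset ht))
  simpa using this ⟨le_rfl, hab⟩ ⟨hab, le_rfl⟩ hab

/-! ### Thompson's metric in terms of order bounds. -/

section Thompson

theorem eq_zero_of_mem_of_neg_mem (hC : IsPointed C) {x : X} (hx : x ∈ C) (hx' : -x ∈ C) :
    x = 0 := by
  have : x ∈ (C : Set X) ∩ {x | -x ∈ C} := ⟨hx, hx'⟩
  rwa [hC] at this

/-- Otherwise `x = 0` by pointedness, and a cone with `0` in its interior is the whole space. -/
theorem neg_notMem_of_mem_coneInterior [Nontrivial X] (hC : IsPointed C) {x : X}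
    (hx : x ∈ coneInterior C) : -x ∉ C := by
  intro h
  obtain rfl := eq_zero_of_mem_of_neg_mem hC (mem_of_mem_coneInterior hx) h
  obtain ⟨κ, -, hκ⟩ := exists_forall_smul_add_mem hx
  obtain ⟨v, hv⟩ := exists_ne (0 : X)
  exact hv (eq_zero_of_mem_of_neg_mem hC (by simpa using hκ v) (by simpa using hκ (-v)))

theorem pos_of_coneLE_smul [Nontrivial X] (hC : IsPointed C) {x y : X} (hx : x ∈ coneInterior C)
    (hy : y ∈ coneInterior C) {t : ℝ} (h : ConeLE C x (t • y)) : 0 < t := by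
  by_contra! ht
  refine neg_notMem_of_mem_coneInterior hC hx ?_
  have := C.add_mem h (C.smul_mem (mem_of_mem_coneInterior hy) (neg_nonneg.2 ht))
  rw [show t • y - x + -t • y = -x by module] at this
  exact this

theorem bddBelow_gauge [Nontrivial X] (hC : IsPointed C) {x y : X} (hx : x ∈ coneInterior C)
    (hy : y ∈ coneInterior C) : BddBelow {t : ℝ | ConeLE C x (t • y)} :=
  ⟨0, fun _ ht => (pos_of_coneLE_smul hC hx hy ht).le⟩

/-- The infimum is attained: the set of admissible `t` is closed like the cone, nonempty because `y`
is an order unit, and bounded below. -/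
theorem coneLE_gaugeM_smul [Nontrivial X] (hC : IsPointed C) {x y : X} (hx : x ∈ coneInterior C)
    (hy : y ∈ coneInterior C) : ConeLE C x (gaugeM C x y • y) := by
  have hclosed : IsClosed {t : ℝ | ConeLE C x (t • y)} :=
    C.isClosed.preimage (f := fun t : ℝ => t • y - x) (by fun_prop)
  obtain ⟨κ, -, hκ⟩ := exists_forall_smul_add_mem hy
  exact hclosed.csInf_mem ⟨κ * ‖-x‖, by
    simpa [ConeLE, sub_eq_add_neg] using hκ (-x)⟩ (bddBelow_gauge hC hx hy)

theorem coneLE_smul_of_le {x y : X} (hy : y ∈ C) {r r' : ℝ} (h : ConeLE C x (r • y))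
    (hr : r ≤ r') : ConeLE C x (r' • y) := by
  have := C.add_mem h (C.smul_mem hy (sub_nonneg.2 hr))
  rw [show r • y - x + (r' - r) • y = r' • y - x by module] at this
  exact this

theorem thompsonDist_comm (x y : X) : thompsonDist C x y = thompsonDist C y x := by
  rw [thompsonDist, thompsonDist, max_comm]

theorem coneLE_exp_thompsonDist [Nontrivial X] (hC : IsPointed C) {x y : X}
    (hx : x ∈ coneInterior C) (hy : y ∈ coneInterior C) :
    ConeLE C x (Real.exp (thompsonDist C x y) • y) := by
  have h := coneLE_gaugeM_smul hC hx hy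
  rw [thompsonDist, Real.exp_log (lt_max_of_lt_left (pos_of_coneLE_smul hC hx hy h))]
  exact coneLE_smul_of_le (mem_of_mem_coneInterior hy) h (le_max_left _ _)

theorem thompsonDist_le [Nontrivial X] (hC : IsPointed C) {x y : X} (hx : x ∈ coneInterior C)
    (hy : y ∈ coneInterior C) {r : ℝ} (hxy : ConeLE C x (Real.exp r • y))
    (hyx : ConeLE C y (Real.exp r • x)) : thompsonDist C x y ≤ r := by
  have hpos : 0 < max (gaugeM C x y) (gaugeM C y x) :=
    lt_max_of_lt_left (pos_of_coneLE_smul hC hx hy (coneLE_gaugeM_smul hC hx hy))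
  rw [thompsonDist, Real.log_le_iff_le_exp hpos]
  exact max_le (csInf_le (bddBelow_gauge hC hx hy) hxy) (csInf_le (bddBelow_gauge hC hy hx) hyx)

theorem thompsonDist_nonneg [Nontrivial X] (hC : IsPointed C) {x y : X}
    (hx : x ∈ coneInterior C) (hy : y ∈ coneInterior C) : 0 ≤ thompsonDist C x y := by
  by_contra! hneg
  have h1 := coneLE_exp_thompsonDist hC hx hy
  have h2 := coneLE_exp_thompsonDist hC hy hx
  rw [thompsonDist_comm y x] at h2
  set m := Real.exp (thompsonDist C x y)
  have hm : m < 1 := (Real.exp_lt_exp.2 hneg).trans_eq Real.exp_zero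
  have hm0 : 0 < m := Real.exp_pos _
  refine neg_notMem_of_mem_coneInterior hC hx ?_
  -- From `x ≤ m y` and `y ≤ m x` follows `x ≤ m² x`; with `m < 1` this forces `-x ∈ C`.
  have h3 := C.smul_mem (C.add_mem h1 (C.smul_mem h2 hm0.le))
    (show 0 ≤ (1 - m * m)⁻¹ from inv_nonneg.2 (by nlinarith))
  have h4 : (1 - m * m)⁻¹ • ((m • y - x) + m • (m • x - y)) = -x := by
    have : (m • y - x) + m • (m • x - y) = (1 - m * m) • (-x) := by module
    rw [this, smul_smul, inv_mul_cancel₀ (by nlinarith), one_smul]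
  rwa [h4] at h3

/-- In the zero space every `t` is admissible; the default values `sInf univ = 0` and `log 0 = 0`
decide. -/
theorem thompsonDist_eq_zero_of_subsingleton [Subsingleton X] (x y : X) :
    thompsonDist C x y = 0 := by
  have h : ∀ x y : X, gaugeM C x y = 0 := fun x y => by
    have : {t : ℝ | ConeLE C x (t • y)} = univ := eq_univ_of_forall fun t => by
      have : t • y - x = 0 := Subsingleton.elim _ _
      simp [ConeLE, this]
    rw [gaugeM, this, Real.sInf_of_not_bddBelow not_bddBelow_univ]
  simp [thompsonDist, h]

end Thompson

/-! ### The infinitesimal condition and its integrated form. -/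

section ScalingDefect

/-- The defect of the inequality `φ(t, eʳx) ≤ eʳ(φ(t,x) - αrx)`, divided by `eʳ`. -/
def scalingDefect (φ : ℝ → X → X) (α t : ℝ) (x : X) (r : ℝ) : X :=
  φ t x - (α * r) • x - Real.exp (-r) • φ t (Real.exp r • x)

theorem scalingDefect_zero (α t : ℝ) (x : X) : scalingDefect φ α t x 0 = 0 := by
  simp [scalingDefect]

theorem hasDerivAt_scalingDefect {α t : ℝ} {x : X} {r : ℝ}
    (h : DifferentiableAt ℝ (φ t) (Real.exp r • x)) :
    HasDerivAt (scalingDefect φ α t x)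
      (Real.exp (-r) • (-(α • Real.exp r • x) -
        (fderiv ℝ (φ t) (Real.exp r • x) (Real.exp r • x) - φ t (Real.exp r • x)))) r := by
  have h1 : HasDerivAt (fun r : ℝ => Real.exp r • x) (Real.exp r • x) r :=
    (Real.hasDerivAt_exp r).smul_const x
  have h2 := h.hasFDerivAt.comp_hasDerivAt r h1
  have h3 : HasDerivAt (fun r : ℝ => Real.exp (-r)) (-Real.exp (-r)) r := by
    simpa using (hasDerivAt_neg r).exp
  have h4 : HasDerivAt (fun r : ℝ => (α * r) • x) (α • x) r := by
    simpa using ((hasDerivAt_id r).const_mul α).smul_const x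
  refine ((h4.const_sub (φ t x)).sub (h3.smul h2)).congr_deriv ?_
  have h5 : Real.exp (-r) * Real.exp r = 1 := by rw [← Real.exp_add]; simp
  simp only [smul_sub, smul_neg, smul_comm α (Real.exp r) x, Function.comp_apply]
  rw [smul_smul (Real.exp (-r)) (Real.exp r) (α • x), h5]
  module

/-- The infinitesimal contraction condition in integrated form. -/
theorem InfinitesimalContraction.scalingDefect_mem {α : ℝ}
    (hφ : IsRegularField φ (coneInterior C) T)
    (h : InfinitesimalContraction C φ T (coneInterior C) α) {t : ℝ} (ht : t ∈ timeInterval T)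
    {x : X} (hx : x ∈ coneInterior C) {r : ℝ} (hr : 0 ≤ r) : scalingDefect φ α t x r ∈ C := by
  have hmem : ∀ u : ℝ, Real.exp u • x ∈ coneInterior C := fun u =>
    smul_mem_coneInterior hx (Real.exp_pos u)
  simpa [scalingDefect_zero] using sub_mem_of_hasDerivAt (C := C) hr
    (fun u _ => hasDerivAt_scalingDefect (α := α) (hφ.differentiableAt t ht _ (hmem u)))
    fun u _ => C.smul_mem (h t ht _ (hmem u)) (Real.exp_pos _).le

/-- The infinitesimal contraction condition follows from its integrated form. -/
theorem infinitesimalContraction_of_scalingDefect_mem {α : ℝ}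
    (hφ : IsRegularField φ (coneInterior C) T)
    (h : ∀ t ∈ timeInterval T, ∀ x ∈ coneInterior C, ∀ r > 0, scalingDefect φ α t x r ∈ C) :
    InfinitesimalContraction C φ T (coneInterior C) α := by
  intro t ht x hx
  have hd := hasDerivAt_scalingDefect (φ := φ) (α := α) (t := t) (x := x) (r := 0)
    (hφ.differentiableAt t ht _ (by simpa using hx))
  simpa [ConeLE] using mem_of_hasDerivWithinAt (C := C) one_pos hd.hasDerivWithinAt
    (scalingDefect_zero α t x) fun r hr => h t ht x hx r hr.1

end ScalingDefect

/-! ### Quasimonotonicity and the comparison principle. -/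

section Comparison

theorem nonpos_of_hasDerivAt_of_nonneg_left {g : ℝ → ℝ} {g' s t : ℝ} (hst : s < t)
    (hg : HasDerivAt g g' t) (h0 : g t = 0) (h : ∀ u ∈ Ioo s t, 0 ≤ g u) : g' ≤ 0 := by
  have := (hasDerivWithinAt_iff_tendsto_slope' self_notMem_Iio).1 (hg.hasDerivWithinAt (s := Iio t))
  refine le_of_tendsto this ?_
  filter_upwards [Ioo_mem_nhdsLT hst] with u hu
  rw [slope_def_field, h0, sub_zero]
  exact div_nonpos_of_nonneg_of_nonpos (h u hu) (sub_nonpos.2 hu.2.le)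

variable [CompleteSpace X]

/-- The vector field of an order-preserving flow is quasimonotone. -/
theorem IsOrderPreservingOn.le_of_dual_eq (hφ : IsRegularField φ (coneInterior C) T)
    (hmono : IsOrderPreservingOn C φ (coneInterior C) T (coneInterior C)) {τ : ℝ}
    (hτ : τ ∈ timeInterval T) {y z : X} (hy : y ∈ coneInterior C) (hz : z ∈ coneInterior C)
    (hyz : z - y ∈ C) {ψ : StrongDual ℝ X} (hψ : ∀ x ∈ C, 0 ≤ ψ x) (h0 : ψ (z - y) = 0) :
    ψ (φ τ y) ≤ ψ (φ τ z) := by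
  have hY := isSolution_flow isOpen_coneInterior hφ hτ hy
  have hZ := isSolution_flow isOpen_coneInterior hφ hτ hz
  have hYτ := lt_maxTime isOpen_coneInterior hφ hτ hy
  have hZτ := lt_maxTime isOpen_coneInterior hφ hτ hz
  obtain ⟨ε, hε, hlt⟩ := exists_add_lt_of_lt (lt_min hYτ hZτ)
  have hd := ((hZ.2 τ le_rfl hZτ).2.sub (hY.2 τ le_rfl hYτ).2)
  have hd' := ψ.hasFDerivAt.comp_hasDerivWithinAt τ hd
  -- The scalar function `ψ` of the difference of the two trajectories vanishes at `τ` and is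
  -- nonnegative afterwards, so its right derivative at `τ` is nonnegative.
  have key := mem_of_hasDerivWithinAt (C := ProperCone.positive ℝ ℝ) (lt_add_of_pos_right τ hε) hd'
    (by simpa [hY.1, hZ.1] using h0) fun t ht => by
      refine hψ _ (hmono z hz y hy hyz τ t hτ.1 ht.1.le ?_)
      rw [exitTime_eq_maxTime isOpen_coneInterior hφ hτ hy,
        exitTime_eq_maxTime isOpen_coneInterior hφ hτ hz, min_comm]
      exact (EReal.coe_lt_coe_iff.2 ht.2).trans hlt
  have key' : 0 ≤ ψ (φ τ (flow φ (coneInterior C) T τ τ z) - φ τ (flow φ (coneInterior C) T τ τ y)) :=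
    key
  have e1 : flow φ (coneInterior C) T τ τ z = z := hZ.1
  have e2 : flow φ (coneInterior C) T τ τ y = y := hY.1
  rw [e1, e2, map_sub] at key'
  linarith

/-- Comparison of subsolutions and supersolutions of an order-preserving flow. -/
theorem IsOrderPreservingOn.sub_mem_of_subsolution (hφ : IsRegularField φ (coneInterior C) T)
    (hmono : IsOrderPreservingOn C φ (coneInterior C) T (coneInterior C)) {s t₁ : ℝ} (hs : 0 ≤ s)
    (hst : s ≤ t₁) (hT : (t₁ : EReal) < T) {y z y' z' : ℝ → X}
    (hy : ∀ t ∈ Icc s t₁, y t ∈ coneInterior C) (hz : ∀ t ∈ Icc s t₁, z t ∈ coneInterior C)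
    (hyd : ∀ t ∈ Icc s t₁, HasDerivWithinAt y (y' t) (Ici s) t)
    (hzd : ∀ t ∈ Icc s t₁, HasDerivWithinAt z (z' t) (Ici s) t)
    (hsub : ∀ t ∈ Icc s t₁, φ t (y t) - y' t ∈ C)
    (hsup : ∀ t ∈ Icc s t₁, z' t - φ t (z t) ∈ C) (h0 : z s - y s ∈ C) : z t₁ - y t₁ ∈ C := by
  set e := y s
  have he : e ∈ coneInterior C := hy s ⟨le_rfl, hst⟩
  obtain ⟨κ, hκ, hunit⟩ := exists_forall_smul_add_mem he
  have hyc : ContinuousOn y (Icc s t₁) := fun t ht =>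
    (hyd t ht).continuousWithinAt.mono Icc_subset_Ici_self
  have hzc : ContinuousOn z (Icc s t₁) := fun t ht =>
    (hzd t ht).continuousWithinAt.mono Icc_subset_Ici_self
  have hK : IsCompact (z '' Icc s t₁) := isCompact_Icc.image_of_continuousOn hzc
  obtain ⟨δ, hδ, hthick⟩ := hK.exists_cthickening_subset_open isOpen_coneInterior
    (image_subset_iff.2 hz)
  obtain ⟨L, hL⟩ := hφ.bounded_fderiv _ hthick Metric.isClosed_cthickening hK.isBounded.cthickening
  -- Raising `z` by `w • e` changes the field by at most `κ |L| ‖e‖ w • e` in the order. The growth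
  -- rate `B` of `w` beats this, and the extra `1` makes the inequality strict.
  set B : ℝ := κ * (|L| * ‖e‖) + 1 with hB
  set E : ℝ := Real.exp (B * (t₁ - s))
  have main : ∀ ε > 0, ε * E * ‖e‖ ≤ δ → z t₁ + (ε * E) • e - y t₁ ∈ C := by
    intro ε hε hεδ
    set w : ℝ → ℝ := fun t => ε * Real.exp (B * (t - s)) with hw
    have hwpos : ∀ t, 0 < w t := fun t => by positivity
    have hBpos : 0 < B := by positivity
    have hwd : ∀ t, HasDerivAt w (B * w t) t := fun t => by
      have := ((((hasDerivAt_id t).sub_const s).const_mul B).exp).const_mul ε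
      refine this.congr_deriv ?_
      simp only [hw, id]
      ring
    have hwE : ∀ t ∈ Icc s t₁, w t * ‖e‖ ≤ δ := fun t ht => by
      refine le_trans ?_ hεδ
      have : Real.exp (B * (t - s)) ≤ E := Real.exp_le_exp.2 (by nlinarith [ht.2])
      simp only [hw]
      gcongr
    set p : ℝ → X := fun t => z t + w t • e - y t with hp
    have hpd : ∀ t ∈ Icc s t₁,
        HasDerivWithinAt p (z' t + (B * w t) • e - y' t) (Ici s) t := fun t ht =>
      ((hzd t ht).add ((hwd t).hasDerivWithinAt.smul_const e)).sub (hyd t ht)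
    have hpc : ContinuousOn p (Icc s t₁) := fun t ht =>
      (hpd t ht).continuousWithinAt.mono Icc_subset_Ici_self
    by_contra hcon
    have hNclosed : IsClosed (Icc s t₁ ∩ p ⁻¹' (coneInterior C)ᶜ) :=
      hpc.preimage_isClosed_of_isClosed isClosed_Icc isOpen_coneInterior.isClosed_compl
    have hNcomp : IsCompact (Icc s t₁ ∩ p ⁻¹' (coneInterior C)ᶜ) :=
      isCompact_Icc.of_isClosed_subset hNclosed inter_subset_left
    -- At the first time `c` when `p` leaves the interior, `p c` is on the boundary. Along a
    -- supporting functional the derivative of `p` must be nonpositive there, while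
    -- quasimonotonicity and the choice of `B` make it positive.
    obtain ⟨c, ⟨hcI, hcN⟩, hcmin⟩ := hNcomp.exists_isLeast
      ⟨t₁, ⟨hst, le_rfl⟩, fun h => hcon (mem_of_mem_coneInterior h)⟩
    have hbefore : ∀ t ∈ Ico s c, p t ∈ coneInterior C := fun t ht => by
      by_contra h
      exact (hcmin ⟨⟨ht.1, ht.2.le.trans hcI.2⟩, h⟩).not_gt ht.2
    have hps : p s ∈ coneInterior C := by
      have := add_mem_coneInterior (smul_mem_coneInterior he (hwpos s)) h0
      convert this using 1
      simp only [hp]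
      abel
    have hsc : s < c := lt_of_le_of_ne hcI.1 fun h => hcN (h ▸ hps)
    have hpc' : p c ∈ C := by
      have h1 : Filter.Tendsto p (𝓝[<] c) (𝓝 (p c)) :=
        (hpc c hcI).mono_of_mem_nhdsWithin (Filter.mem_of_superset (Ioo_mem_nhdsLT hsc)
          fun u hu => ⟨hu.1.le, hu.2.le.trans hcI.2⟩)
      refine C.isClosed.mem_of_tendsto h1 ?_
      filter_upwards [Ioo_mem_nhdsLT hsc] with u hu
      exact mem_of_mem_coneInterior (hbefore u ⟨hu.1.le, hu.2⟩)
    obtain ⟨ψ, hψ, hψe, hψp⟩ := exists_supporting_functional he hpc' hcN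
    have hle := nonpos_of_hasDerivAt_of_nonneg_left hsc
      (ψ.hasFDerivAt.comp_hasDerivAt c ((hpd c hcI).hasDerivAt (Ici_mem_nhds hsc))) hψp
      fun u hu => hψ _ (mem_of_mem_coneInterior (hbefore u ⟨hu.1.le, hu.2⟩))
    have hcJ : c ∈ timeInterval T := mem_timeInterval_of_le hT (hs.trans hcI.1) hcI.2
    have hzε : z c + w c • e ∈ coneInterior C :=
      add_mem_coneInterior (hz c hcI) (C.smul_mem (mem_of_mem_coneInterior he) (hwpos c).le)
    have hqm := hmono.le_of_dual_eq hφ hcJ (hy c hcI) hzε hpc' hψ hψp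
    have hball : Metric.closedBall (z c) δ ⊆ Metric.cthickening δ (z '' Icc s t₁) :=
      Metric.closedBall_subset_cthickening (mem_image_of_mem z hcI) δ
    have hlip : ‖φ c (z c) - φ c (z c + w c • e)‖ ≤ |L| * (w c * ‖e‖) := by
      have h1 : z c + w c • e ∈ Metric.closedBall (z c) δ := by
        rw [mem_closedBall_iff_norm, add_sub_cancel_left, norm_smul,
          Real.norm_of_nonneg (hwpos c).le]
        exact hwE c hcI
      have h2 := (convex_closedBall (z c) δ).norm_image_sub_le_of_norm_fderiv_le (𝕜 := ℝ)
        (f := φ c) (C := |L|)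
        (fun x hx => hφ.differentiableAt c hcJ x (hthick (hball hx)))
        (fun x hx => (hL c hcJ x (hball hx)).trans (le_abs_self L)) h1
        (Metric.mem_closedBall_self hδ.le)
      refine h2.trans_eq ?_
      rw [norm_sub_rev, add_sub_cancel_left, norm_smul, Real.norm_of_nonneg (hwpos c).le]
    have h1 := hψ _ (hunit (φ c (z c) - φ c (z c + w c • e)))
    have h2 := hψ _ (hsub c hcI)
    have h3 := hψ _ (hsup c hcI)
    simp only [map_add, map_sub, map_smul, smul_eq_mul] at h1 h2 h3 hle
    have h4 : κ * ‖φ c (z c) - φ c (z c + w c • e)‖ * ψ e ≤ κ * (|L| * (w c * ‖e‖)) * ψ e := by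
      gcongr
    have h5 : 0 < w c * ψ e := mul_pos (hwpos c) hψe
    rw [hB] at hle
    nlinarith
  have hlim : Filter.Tendsto (fun ε : ℝ => z t₁ + (ε * E) • e - y t₁) (𝓝[>] 0)
      (𝓝 (z t₁ + ((0 : ℝ) * E) • e - y t₁)) :=
    (Continuous.tendsto (by fun_prop) 0).mono_left nhdsWithin_le_nhds
  have hsmall : Filter.Tendsto (fun ε : ℝ => ε * E * ‖e‖) (𝓝[>] 0) (𝓝 ((0 : ℝ) * E * ‖e‖)) :=
    (Continuous.tendsto (by fun_prop) 0).mono_left nhdsWithin_le_nhds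
  rw [zero_mul, zero_smul, add_zero] at hlim
  rw [zero_mul, zero_mul] at hsmall
  refine C.isClosed.mem_of_tendsto hlim ?_
  filter_upwards [self_mem_nhdsWithin, hsmall.eventually (gt_mem_nhds hδ)] with ε h1 h2
    using main ε h1 h2.le

end Comparison

/-! ### Equivalence of contraction and the infinitesimal condition. -/

section Contraction

theorem mem_timeInterval_of_lt_min_exitTime {x₁ x₂ : X} {s t : ℝ} (hs : 0 ≤ s) (hst : s ≤ t)
    (ht : (t : EReal) < min (exitTime φ (coneInterior C) T (coneInterior C) s x₁)
      (exitTime φ (coneInterior C) T (coneInterior C) s x₂)) : s ∈ timeInterval T := by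
  have h : exitTime φ (coneInterior C) T (coneInterior C) s x₁ ≤ T :=
    sSup_le fun b hb => hb.2.1.le.trans maxTime_le
  exact mem_timeInterval_of_le (ht.trans_le ((min_le_left _ _).trans h)) hs hst

variable [CompleteSpace X] {α : ℝ}

/-- The infinitesimal contraction condition propagates order bounds between trajectories. -/
theorem IsOrderPreservingOn.flow_le_exp_smul_flow (hφ : IsRegularField φ (coneInterior C) T)
    (hmono : IsOrderPreservingOn C φ (coneInterior C) T (coneInterior C))
    (hinf : InfinitesimalContraction C φ T (coneInterior C) α) {x₁ x₂ : X}
    (hx₁ : x₁ ∈ coneInterior C) (hx₂ : x₂ ∈ coneInterior C) {s t : ℝ} (hs : s ∈ timeInterval T)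
    (hst : s ≤ t) (ht₁ : (t : EReal) < maxTime φ (coneInterior C) T s x₁)
    (ht₂ : (t : EReal) < maxTime φ (coneInterior C) T s x₂) {r : ℝ} (hr : 0 ≤ r)
    (hle : ConeLE C x₂ (Real.exp r • x₁)) :
    ConeLE C (flow φ (coneInterior C) T s t x₂)
      (Real.exp (Real.exp (-α * (t - s)) * r) • flow φ (coneInterior C) T s t x₁) := by
  have hX := isSolution_flow isOpen_coneInterior hφ hs hx₁
  have hY := isSolution_flow isOpen_coneInterior hφ hs hx₂
  set x : ℝ → X := fun t => flow φ (coneInterior C) T s t x₁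
  set y : ℝ → X := fun t => flow φ (coneInterior C) T s t x₂
  set ρ : ℝ → ℝ := fun τ => Real.exp (-α * (τ - s)) * r with hρ
  have hρd : ∀ τ, HasDerivAt ρ (-α * ρ τ) τ := fun τ => by
    have := ((((hasDerivAt_id τ).sub_const s).const_mul (-α)).exp).mul_const r
    refine this.congr_deriv ?_
    simp only [hρ, id]
    ring
  have hlt₁ : ∀ τ ∈ Icc s t, (τ : EReal) < maxTime φ (coneInterior C) T s x₁ := fun τ hτ =>
    (EReal.coe_le_coe_iff.2 hτ.2).trans_lt ht₁
  have hlt₂ : ∀ τ ∈ Icc s t, (τ : EReal) < maxTime φ (coneInterior C) T s x₂ := fun τ hτ =>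
    (EReal.coe_le_coe_iff.2 hτ.2).trans_lt ht₂
  refine hmono.sub_mem_of_subsolution hφ hs.1 hst (ht₁.trans_le maxTime_le) (y := y)
    (z := fun τ => Real.exp (ρ τ) • x τ) (y' := fun τ => φ τ (y τ))
    (z' := fun τ => Real.exp (ρ τ) • φ τ (x τ) + (Real.exp (ρ τ) * (-α * ρ τ)) • x τ)
    (fun τ hτ => (hY.2 τ hτ.1 (hlt₂ τ hτ)).1)
    (fun τ hτ => smul_mem_coneInterior (hX.2 τ hτ.1 (hlt₁ τ hτ)).1 (Real.exp_pos _))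
    (fun τ hτ => (hY.2 τ hτ.1 (hlt₂ τ hτ)).2)
    (fun τ hτ => (hρd τ).exp.hasDerivWithinAt.smul (hX.2 τ hτ.1 (hlt₁ τ hτ)).2)
    (fun τ hτ => by simp) (fun τ hτ => ?_) ?_
  -- As `ρ' = -αρ`, the supersolution inequality for `e^ρ x` is exactly `e^ρ` times the scaling
  -- defect at `r = ρ`.
  · have h := C.smul_mem (hinf.scalingDefect_mem hφ
      (mem_timeInterval_of_le (ht₁.trans_le maxTime_le) (hs.1.trans hτ.1) hτ.2)
      (hX.2 τ hτ.1 (hlt₁ τ hτ)).1 (show 0 ≤ ρ τ by positivity)) (Real.exp_pos (ρ τ)).le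
    have e : Real.exp (ρ τ) • scalingDefect φ α τ (x τ) (ρ τ) =
        Real.exp (ρ τ) • φ τ (x τ) + (Real.exp (ρ τ) * (-α * ρ τ)) • x τ -
          φ τ (Real.exp (ρ τ) • x τ) := by
      have h5 : Real.exp (ρ τ) * Real.exp (-ρ τ) = 1 := by rw [← Real.exp_add]; simp
      rw [scalingDefect, smul_sub, smul_smul _ (Real.exp (-ρ τ)), h5]
      module
    rw [← e]
    exact h
  · have e1 : x s = x₁ := hX.1
    have e2 : y s = x₂ := hY.1
    simp only [e1, e2, hρ]
    simpa [ConeLE] using hle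

theorem InfinitesimalContraction.contractsThompson (hC : IsPointed C)
    (hφ : IsRegularField φ (coneInterior C) T)
    (hmono : IsOrderPreservingOn C φ (coneInterior C) T (coneInterior C))
    (hinf : InfinitesimalContraction C φ T (coneInterior C) α) :
    ContractsThompson C φ (coneInterior C) T (coneInterior C) α := by
  intro x₁ hx₁ x₂ hx₂ s t hs0 hst ht
  cases subsingleton_or_nontrivial X
  · simp [thompsonDist_eq_zero_of_subsingleton]
  have hs := mem_timeInterval_of_lt_min_exitTime hs0 hst ht
  rw [exitTime_eq_maxTime isOpen_coneInterior hφ hs hx₁,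
    exitTime_eq_maxTime isOpen_coneInterior hφ hs hx₂, lt_min_iff] at ht
  have hr := thompsonDist_nonneg hC hx₁ hx₂
  have h21 := coneLE_exp_thompsonDist hC hx₂ hx₁
  rw [thompsonDist_comm] at h21
  exact thompsonDist_le hC ((isSolution_flow isOpen_coneInterior hφ hs hx₁).2 t hst ht.1).1
    ((isSolution_flow isOpen_coneInterior hφ hs hx₂).2 t hst ht.2).1
    (hmono.flow_le_exp_smul_flow hφ hinf hx₂ hx₁ hs hst ht.2 ht.1 hr
      (coneLE_exp_thompsonDist hC hx₁ hx₂))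
    (hmono.flow_le_exp_smul_flow hφ hinf hx₁ hx₂ hs hst ht.1 ht.2 hr h21)

theorem ContractsThompson.infinitesimalContraction (hC : IsPointed C)
    (hφ : IsRegularField φ (coneInterior C) T)
    (h : ContractsThompson C φ (coneInterior C) T (coneInterior C) α) :
    InfinitesimalContraction C φ T (coneInterior C) α := by
  cases subsingleton_or_nontrivial X
  · intro t _ x _
    rw [ConeLE, Subsingleton.elim (_ - _) (0 : X)]
    exact C.zero_mem
  refine infinitesimalContraction_of_scalingDefect_mem hφ fun s hs x hx r hr => ?_
  have hx₁ : Real.exp r • x ∈ coneInterior C := smul_mem_coneInterior hx (Real.exp_pos r)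
  have hX := isSolution_flow isOpen_coneInterior hφ hs hx
  have hY := isSolution_flow isOpen_coneInterior hφ hs hx₁
  have hXs := lt_maxTime isOpen_coneInterior hφ hs hx
  have hYs := lt_maxTime isOpen_coneInterior hφ hs hx₁
  obtain ⟨ε, hε, hlt⟩ := exists_add_lt_of_lt (lt_min hYs hXs)
  have hd : thompsonDist C (Real.exp r • x) x ≤ r := by
    refine thompsonDist_le hC hx₁ hx (by simp [ConeLE]) ?_
    have := C.smul_mem (mem_of_mem_coneInterior hx)
      (show 0 ≤ Real.exp r * Real.exp r - 1 by nlinarith [Real.add_one_le_exp r])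
    rw [sub_smul, one_smul, mul_smul] at this
    exact this
  set ρ : ℝ → ℝ := fun τ => Real.exp (-α * (τ - s)) * r with hρ
  have hρs : ρ s = r := by simp [hρ]
  have hρd : HasDerivAt ρ (-α * r) s := by
    have := ((((hasDerivAt_id s).sub_const s).const_mul (-α)).exp).mul_const r
    refine this.congr_deriv ?_
    simp
  have hder := (hρd.exp.hasDerivWithinAt.smul (hX.2 s le_rfl hXs).2).sub (hY.2 s le_rfl hYs).2
  have e1 : flow φ (coneInterior C) T s s x = x := hX.1
  have e2 : flow φ (coneInterior C) T s s (Real.exp r • x) = Real.exp r • x := hY.1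
  -- The curve `e^{ρ(t)} M_s^t(x) - M_s^t(eʳx)` starts at `0` and contraction keeps it in the cone;
  -- its initial derivative is `eʳ` times the scaling defect.
  have key := mem_of_hasDerivWithinAt (C := C) (lt_add_of_pos_right s hε) hder
    (by simp [e1, e2, hρs]) fun t ht => by
      have htm : (t : EReal) < min (maxTime φ (coneInterior C) T s (Real.exp r • x))
          (maxTime φ (coneInterior C) T s x) := (EReal.coe_lt_coe_iff.2 ht.2).trans hlt
      obtain ⟨h1, h2⟩ := lt_min_iff.1 htm
      have hm1 := (hX.2 t ht.1.le h2).1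
      have hm2 := (hY.2 t ht.1.le h1).1
      rw [← exitTime_eq_maxTime isOpen_coneInterior hφ hs hx,
        ← exitTime_eq_maxTime isOpen_coneInterior hφ hs hx₁] at htm
      have h3 := (h _ hx₁ x hx s t hs.1 ht.1.le htm).trans
        (mul_le_mul_of_nonneg_left hd (Real.exp_pos _).le)
      exact coneLE_smul_of_le (mem_of_mem_coneInterior hm1) (coneLE_exp_thompsonDist hC hm2 hm1)
        (Real.exp_le_exp.2 h3)
  have h4 := C.smul_mem key (Real.exp_pos (-r)).le
  convert h4 using 2
  have h5 : Real.exp (-r) * Real.exp r = 1 := by rw [← Real.exp_add]; simp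
  simp only [e1, e2, hρs, smul_sub, smul_add, smul_smul, ← mul_assoc, h5, scalingDefect]
  module

end Contraction

/-! ### Exponential barriers and global existence. -/

section Invariance

/-- The order interval `[a, b]`. -/
def orderInterval (C : ProperCone ℝ X) (a b : X) : Set X := {v | v - a ∈ C ∧ b - v ∈ C}

theorem orderInterval_subset_coneInterior {a b : X} (ha : a ∈ coneInterior C) :
    orderInterval C a b ⊆ coneInterior C := fun v hv => by
  simpa using add_mem_coneInterior ha hv.1

theorem isClosed_orderInterval {a b : X} : IsClosed (orderInterval C a b) :=
  (C.isClosed.preimage (f := fun v => v - a) (by fun_prop)).inter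
    (C.isClosed.preimage (f := fun v => b - v) (by fun_prop))

theorem convex_orderInterval {a b : X} : Convex ℝ (orderInterval C a b) := by
  intro v hv w hw m n hm hn hmn
  obtain rfl : n = 1 - m := by linarith
  constructor
  · have := C.add_mem (C.smul_mem hv.1 hm) (C.smul_mem hw.1 hn)
    rwa [show m • (v - a) + (1 - m) • (w - a) = m • v + (1 - m) • w - a by module] at this
  · have := C.add_mem (C.smul_mem hv.2 hm) (C.smul_mem hw.2 hn)
    rwa [show m • (b - v) + (1 - m) • (b - w) = b - (m • v + (1 - m) • w) by module] at this

/-- The only place where normality enters: with `a ≥ 0`, the interval lies between `0` and `b`. -/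
theorem IsNormalCone.isBounded_orderInterval (hN : IsNormalCone C) {a b : X} (ha : a ∈ C) :
    Bornology.IsBounded (orderInterval C a b) := by
  obtain ⟨γ, hγ⟩ := hN
  refine isBounded_iff_forall_norm_le.2 ⟨γ * ‖b‖, fun v hv => hγ v b ?_ hv.2⟩
  have := C.add_mem ha hv.1
  rw [add_sub_cancel] at this
  simpa [ConeLE] using this

variable [CompleteSpace X] {α : ℝ}

/-- On a bounded time interval, a trajectory stays in an order interval around its initial value. -/
theorem IsOrderPreservingOn.exists_mem_orderInterval
    (hφ : IsRegularField φ (coneInterior C) T)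
    (hmono : IsOrderPreservingOn C φ (coneInterior C) T (coneInterior C))
    (hinf : InfinitesimalContraction C φ T (coneInterior C) α) {x₀ : X}
    (hx₀ : x₀ ∈ coneInterior C) {s a : ℝ} (hs : 0 ≤ s) (hsa : s < a) (ha : (a : EReal) < T)
    {x : ℝ → X} (hx : IsSolution φ (coneInterior C) s x₀ a x) :
    ∃ U ≥ (0 : ℝ), ∀ t ∈ Ico s a,
      x t ∈ orderInterval C (Real.exp (-U) • x₀) (Real.exp U • x₀) := by
  obtain ⟨κ, hκ, hunit⟩ := exists_forall_smul_add_mem hx₀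
  have hJ : Icc s a ⊆ timeInterval T := fun t ht =>
    mem_timeInterval_of_le ha (hs.trans ht.1) ht.2
  obtain ⟨M, hM⟩ := isCompact_Icc.exists_bound_of_continuousOn
    ((hφ.continuousOn_const hx₀).mono hJ)
  have hM0 : 0 ≤ M := (norm_nonneg _).trans (hM s ⟨le_rfl, hsa.le⟩)
  set c : ℝ := κ * M
  have hc : 0 ≤ c := by positivity
  have hx₀C : x₀ ∈ C := mem_of_mem_coneInterior hx₀
  have hbd : ∀ t ∈ Icc s a, ∀ k, c ≤ k → k • x₀ + φ t x₀ ∈ C ∧ k • x₀ - φ t x₀ ∈ C := by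
    intro t ht k hk
    have h1 : κ * ‖φ t x₀‖ ≤ k := (mul_le_mul_of_nonneg_left (hM t ht) hκ.le).trans hk
    have h2 := C.smul_mem hx₀C (sub_nonneg.2 h1)
    have h3 := C.add_mem h2 (hunit (φ t x₀))
    have h4 := C.add_mem h2 (hunit (-φ t x₀))
    rw [norm_neg] at h4
    constructor
    · exact mem_of_eq_of_mem (by module) h3
    · exact mem_of_eq_of_mem (by module) h4
  -- This rate gives `(B + α) u ≥ u ≥ c`, so the barriers' growth absorbs both `-αu` and the field
  -- at `x₀`, which lies between `-c x₀` and `c x₀`.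
  set B : ℝ := |α| + 1
  have hB : 0 < B := by positivity
  have hBα : 1 ≤ B + α := by linarith [neg_abs_le α]
  set u : ℝ → ℝ := fun t => c * Real.exp (B * (t - s)) with hu
  have hud : ∀ t, HasDerivAt u (B * u t) t := fun t => by
    have := ((((hasDerivAt_id t).sub_const s).const_mul B).exp).const_mul c
    refine this.congr_deriv ?_
    simp only [hu, id]
    ring
  have hu0 : ∀ t, 0 ≤ u t := fun t => by positivity
  have huc : ∀ t ∈ Icc s a, c ≤ (B + α) * u t := fun t ht => by
    have h1 : 1 ≤ Real.exp (B * (t - s)) :=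
      Real.one_le_exp (mul_nonneg hB.le (sub_nonneg.2 ht.1))
    have h2 : c ≤ u t := le_mul_of_one_le_right hc h1
    exact h2.trans (le_mul_of_one_le_left (hu0 t) hBα)
  have hua : ∀ t ∈ Icc s a, u t ≤ u a := fun t ht =>
    mul_le_mul_of_nonneg_left (Real.exp_le_exp.2
      (mul_le_mul_of_nonneg_left (by linarith [ht.2]) hB.le)) hc
  refine ⟨u a, hu0 a, fun t ht => ?_⟩
  have hsub : Icc s t ⊆ Icc s a := Icc_subset_Icc_right ht.2.le
  have htT : (t : EReal) < T := (EReal.coe_lt_coe_iff.2 ht.2).trans ha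
  have hxt : ∀ τ ∈ Icc s t, x τ ∈ coneInterior C ∧ HasDerivWithinAt x (φ τ (x τ)) (Ici s) τ :=
    fun τ hτ => hx.2 τ hτ.1 (EReal.coe_lt_coe_iff.2 (hτ.2.trans_lt ht.2))
  have hint : ∀ r : ℝ, Real.exp r • x₀ ∈ coneInterior C := fun r =>
    smul_mem_coneInterior hx₀ (Real.exp_pos r)
  have hexp : ∀ r : ℝ, Real.exp r * Real.exp (-r) = 1 := fun r => by rw [← Real.exp_add]; simp
  have hlower : x t - Real.exp (-u t) • x₀ ∈ C := by
    refine hmono.sub_mem_of_subsolution hφ hs ht.1 htT (z := x) (z' := fun τ => φ τ (x τ))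
      (y := fun τ => Real.exp (-u τ) • x₀)
      (y' := fun τ => (Real.exp (-u τ) * -(B * u τ)) • x₀)
      (fun τ _ => hint _) (fun τ hτ => (hxt τ hτ).1)
      (fun τ _ => ((hud τ).neg.exp.smul_const x₀).hasDerivWithinAt) (fun τ hτ => (hxt τ hτ).2)
      (fun τ hτ => ?_) (fun τ _ => by simp) ?_
    -- The defect is available only for `r ≥ 0`, so it is taken at the base point `e^{-u} x₀` and
    -- scaled up by `r = u` to reach `x₀`.
    · have h1 := hinf.scalingDefect_mem hφ (hJ (hsub hτ)) (hint (-u τ)) (hu0 τ)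
      have h2 := C.smul_mem (hbd τ (hsub hτ) _ (huc τ (hsub hτ))).1 (Real.exp_pos (-u τ)).le
      have h3 := C.add_mem h1 h2
      rw [scalingDefect, smul_smul (Real.exp (u τ)), hexp, one_smul] at h3
      exact mem_of_eq_of_mem (by module) h3
    · have h1 : Real.exp (-u s) ≤ 1 := Real.exp_le_one_iff.2 (neg_nonpos.2 (hu0 s))
      have h2 := C.smul_mem hx₀C (sub_nonneg.2 h1)
      rw [sub_smul, one_smul] at h2
      simpa only [hx.1] using h2
  have hupper : Real.exp (u t) • x₀ - x t ∈ C := by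
    refine hmono.sub_mem_of_subsolution hφ hs ht.1 htT (y := x) (y' := fun τ => φ τ (x τ))
      (z := fun τ => Real.exp (u τ) • x₀)
      (z' := fun τ => (Real.exp (u τ) * (B * u τ)) • x₀)
      (fun τ hτ => (hxt τ hτ).1) (fun τ _ => hint _) (fun τ hτ => (hxt τ hτ).2)
      (fun τ _ => ((hud τ).exp.smul_const x₀).hasDerivWithinAt)
      (fun τ _ => by simp) (fun τ hτ => ?_) ?_
    · have h1 := hinf.scalingDefect_mem hφ (hJ (hsub hτ)) hx₀ (hu0 τ)
      have h2 := (hbd τ (hsub hτ) _ (huc τ (hsub hτ))).2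
      have h3 := C.smul_mem (C.add_mem h1 h2) (Real.exp_pos (u τ)).le
      rw [scalingDefect, smul_add, smul_sub, smul_smul _ (Real.exp (-u τ)), hexp, one_smul] at h3
      exact mem_of_eq_of_mem (by module) h3
    · have h1 : 1 ≤ Real.exp (u s) := Real.one_le_exp (hu0 s)
      have h2 := C.smul_mem hx₀C (sub_nonneg.2 h1)
      rw [sub_smul, one_smul] at h2
      simpa only [hx.1] using h2
  have hle := hua t ⟨ht.1, ht.2.le⟩
  constructor
  · have h1 := C.smul_mem hx₀C (sub_nonneg.2 (Real.exp_le_exp.2 (neg_le_neg hle)))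
    have h2 := C.add_mem hlower h1
    rw [sub_smul, sub_add_sub_cancel] at h2
    exact h2
  · exact coneLE_smul_of_le hx₀C hupper (Real.exp_le_exp.2 hle)

theorem IsOrderPreservingOn.maxTime_eq (hN : IsNormalCone C)
    (hφ : IsRegularField φ (coneInterior C) T)
    (hmono : IsOrderPreservingOn C φ (coneInterior C) T (coneInterior C))
    (hinf : InfinitesimalContraction C φ T (coneInterior C) α) {s : ℝ} (hs : s ∈ timeInterval T)
    {x₀ : X} (hx₀ : x₀ ∈ coneInterior C) : maxTime φ (coneInterior C) T s x₀ = T := by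
  by_contra hne
  have hlt : maxTime φ (coneInterior C) T s x₀ < T := lt_of_le_of_ne maxTime_le hne
  have hsm := lt_maxTime isOpen_coneInterior hφ hs hx₀
  have hx := isSolution_flow isOpen_coneInterior hφ hs hx₀
  generalize hx_def : (fun t => flow φ (coneInterior C) T s t x₀) = x at hx
  obtain ⟨a, ha⟩ : ∃ a : ℝ, (a : EReal) = maxTime φ (coneInterior C) T s x₀ :=
    ⟨_, EReal.coe_toReal (hlt.trans_le le_top).ne ((bot_le).trans_lt hsm).ne'⟩
  rw [← ha] at hlt hsm hx
  have hsa : s < a := EReal.coe_lt_coe_iff.1 hsm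
  obtain ⟨U, hU, hmem⟩ := hmono.exists_mem_orderInterval hφ hinf hx₀ hs.1 hsa hlt hx
  have hlow : Real.exp (-U) • x₀ ∈ coneInterior C := smul_mem_coneInterior hx₀ (Real.exp_pos _)
  have hKD := orderInterval_subset_coneInterior (b := Real.exp U • x₀) hlow
  have hKb := hN.isBounded_orderInterval (b := Real.exp U • x₀) (mem_of_mem_coneInterior hlow)
  obtain ⟨L, hL⟩ := hφ.exists_lipschitzOnWith hKD isClosed_orderInterval hKb convex_orderInterval
  have hJ : Icc s a ⊆ timeInterval T := fun t ht =>
    mem_timeInterval_of_le hlt (hs.1.trans ht.1) ht.2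
  obtain ⟨M, hM⟩ := isCompact_Icc.exists_bound_of_continuousOn
    ((hφ.continuousOn_const hx₀).mono hJ)
  have hx₀K : x₀ ∈ orderInterval C (Real.exp (-U) • x₀) (Real.exp U • x₀) := by
    have := hmem s ⟨le_rfl, hsa⟩
    rwa [hx.1] at this
  obtain ⟨R, hR⟩ := isBounded_iff_forall_norm_le.1 hKb
  -- Continuity in time bounds the field at the fixed point `x₀`; the Lipschitz bound on the order
  -- interval transfers this to the trajectory.
  have hspeed : ∀ t ∈ Ico s a, ‖φ t (x t)‖₊ ≤ (M + L * (R + R)).toNNReal := by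
    intro t ht
    refine NNReal.coe_le_coe.1 (le_trans ?_ (Real.le_coe_toNNReal _))
    have h1 := (hL t (hJ ⟨ht.1, ht.2.le⟩)).norm_sub_le (hmem t ht) hx₀K
    have h2 : ‖x t - x₀‖ ≤ R + R := (norm_sub_le _ _).trans
      (add_le_add (hR _ (hmem t ht)) (hR _ hx₀K))
    have h3 := norm_le_norm_add_norm_sub' (φ t (x t)) (φ t x₀)
    have h4 := hM t ⟨ht.1, ht.2.le⟩
    have h5 := mul_le_mul_of_nonneg_left h2 L.coe_nonneg
    rw [coe_nnnorm]
    linarith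
  have hlip : LipschitzOnWith (M + L * (R + R)).toNNReal x (Ico s a) :=
    (convex_Ico s a).lipschitzOnWith_of_nnnorm_hasDerivWithin_le (f' := fun t => φ t (x t))
      (fun t ht => (hx.2 t ht.1 (EReal.coe_lt_coe_iff.2 ht.2)).2.mono fun τ hτ => hτ.1) hspeed
  have := lt_maxTime_of_lipschitzOnWith isOpen_coneInterior hφ hs.1 hsa hlt hx hKD
    isClosed_orderInterval hmem hlip
  exact this.ne ha

end Invariance

end ConeFlow

end

theorem mainTheorem6 {X : Type*} [NormedAddCommGroup X] [NormedSpace ℝ X] [CompleteSpace X]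
    (C : ProperCone ℝ X) (hC : ConeFlow.IsPointed C)
    (T : EReal) (hT : 0 < T) (φ : ℝ → X → X)
    (hφ : ConeFlow.IsRegularField φ (ConeFlow.coneInterior C) T) (α : ℝ)
    (hmono : ConeFlow.IsOrderPreservingOn C φ (ConeFlow.coneInterior C) T
      (ConeFlow.coneInterior C)) :
    (ConeFlow.ContractsThompson C φ (ConeFlow.coneInterior C) T (ConeFlow.coneInterior C) α ↔
      ConeFlow.InfinitesimalContraction C φ T (ConeFlow.coneInterior C) α) ∧
    (ConeFlow.IsNormalCone C →
      (ConeFlow.ContractsThompson C φ (ConeFlow.coneInterior C) T (ConeFlow.coneInterior C) α ∨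
        ConeFlow.InfinitesimalContraction C φ T (ConeFlow.coneInterior C) α) →
      ∀ s ∈ ConeFlow.timeInterval T, ∀ x ∈ ConeFlow.coneInterior C,
        ConeFlow.exitTime φ (ConeFlow.coneInterior C) T (ConeFlow.coneInterior C) s x = T) := by
  have hiff : ConeFlow.ContractsThompson C φ (ConeFlow.coneInterior C) T
      (ConeFlow.coneInterior C) α ↔
      ConeFlow.InfinitesimalContraction C φ T (ConeFlow.coneInterior C) α :=
    ⟨fun h => h.infinitesimalContraction hC hφ, fun h => h.contractsThompson hC hφ hmono⟩
  refine ⟨hiff, fun hN h s hs x hx => ?_⟩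
  rw [ConeFlow.exitTime_eq_maxTime ConeFlow.isOpen_coneInterior hφ hs hx]
  exact hmono.maxTime_eq hN hφ (h.elim hiff.1 id) hs hx
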